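/- **Proposition 5.5.** Let $n\ge 1$ and let $\Omega\subset\mathbb R^n$ be a properly convex quasi-homogeneous affine domain. That is, $\Omega$ is a nonempty open convex set which contains no complete affine line, and there are a compact set $K\subset\Omega$ and a group $G$ of affine transformations of $\mathbb R^n$ preserving $\Omega$ such that $GK=\Omega$. Let $$\mathrm{AC}(\Omega)=\{u\in\mathbb R^n \mid x+tu\in\Omega \text{ for all } x\in\Omega,\ t\ge 0\}$$ be the asymptotic cone of $\Omega$; its dimension is the dimension of the linear subspace it spans. 1. $\Omega$ is strictly convex, i.e. its boundary $\partial\Omega$ in $\mathbb R^n$ contains no nondegenerate line segment, if and only if $\mathrm{AC}(\Omega)$ is one-dimensional. 2. If $\Omega$ is strictly convex, then it is also strictly convex as a projective domain: regarded as a subset of $\mathbb{RP}^n=\mathbb P(\mathbb R^n\times\mathbb R)$ via $x\mapsto[x:1]$, it is a convex projective domain (the projectivization of a nonempty open convex cone not containing $0$), and its boundary in $\mathbb{RP}^n$ contains no nondegenerate projective line segment (the image of a segment $[v,w]$ with $v,w$ linearly independent). -/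

import Mathlib

open scoped LinearAlgebra.Projectivization

namespace ConvexDomain

section Affine

variable {E : Type*} [NormedAddCommGroup E] [NormedSpace ℝ E]

/-- A convex affine domain: a nonempty open convex subset. -/
structure IsConvexDomain (Ω : Set E) : Prop where
  nonempty : Ω.Nonempty
  isOpen : IsOpen Ω
  convex : Convex ℝ Ω

/-- A convex affine domain is properly convex if it contains no complete affine line. -/
structure IsProperlyConvex (Ω : Set E) : Prop extends IsConvexDomain Ω where
  no_line : ∀ x v : E, v ≠ 0 → ¬ ∀ t : ℝ, x + t • v ∈ Ω

/-- A convex affine domain is strictly convex if its boundary contains no (nondegenerate)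
line segment. -/
structure IsStrictlyConvex (Ω : Set E) : Prop extends IsConvexDomain Ω where
  no_segment : ∀ a b : E, a ≠ b → ¬ segment ℝ a b ⊆ frontier Ω

/-- The group of all affine transformations preserving `Ω`. -/
def affAut (Ω : Set E) : Subgroup (E ≃ᵃ[ℝ] E) where
  carrier := {g | (g : E → E) '' Ω = Ω}
  one_mem' := by simp
  mul_mem' := by
    intro g h hg hh
    simp only [Set.mem_ofPred_eq] at hg hh ⊢
    rw [AffineEquiv.coe_mul, Set.image_comp, hh, hg]
  inv_mem' := by
    intro g hg
    simp only [Set.mem_ofPred_eq] at hg ⊢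
    conv_lhs => rw [← hg]
    rw [← Set.image_comp, ← AffineEquiv.coe_mul, inv_mul_cancel]
    simp

/-- `Ω` is a quasi-homogeneous affine domain: it is open, and there are a compact `K ⊆ Ω` and a
group `G` of affine automorphisms of `Ω` with `G K = Ω`. -/
def IsQuasiHomogeneous (Ω : Set E) : Prop :=
  IsOpen Ω ∧ ∃ K : Set E, IsCompact K ∧ K ⊆ Ω ∧
    ∃ G : Subgroup (E ≃ᵃ[ℝ] E), G ≤ affAut Ω ∧ (⋃ g ∈ G, (g : E → E) '' K) = Ω

/-- The asymptotic cone of `Ω`. -/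
def asympCone (Ω : Set E) : Set E :=
  {u | ∀ x ∈ Ω, ∀ t : ℝ, 0 ≤ t → x + t • u ∈ Ω}

/-- The dimension of the asymptotic cone: the dimension of the linear subspace it generates. -/
noncomputable def asymptoticDim (Ω : Set E) : ℕ :=
  Module.finrank ℝ (Submodule.span ℝ (asympCone Ω))

end Affine

section Projective

variable {V : Type*} [AddCommGroup V] [TopologicalSpace V] [Module ℝ V]

/-- The quotient topology on projective space, from `V ∖ {0}`. -/
noncomputable instance projectiveTopology : TopologicalSpace (ℙ ℝ V) :=
  TopologicalSpace.coinduced (fun v : {v : V // v ≠ 0} => Projectivization.mk ℝ v.1 v.2)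
    inferInstance

/-- The image in projective space of the nonzero vectors of a set `S ⊆ V`. -/
def projImage (S : Set V) : Set (ℙ ℝ V) :=
  {p | ∃ (v : V) (hv : v ≠ 0), v ∈ S ∧ p = Projectivization.mk ℝ v hv}

/-- A convex projective domain: the projectivization of a nonempty open convex cone which does
not contain the origin. -/
def IsConvexProjDomain (Ω : Set (ℙ ℝ V)) : Prop :=
  ∃ C : ConvexCone ℝ V, (C : Set V).Nonempty ∧ IsOpen (C : Set V) ∧ (0 : V) ∉ C ∧
    Ω = projImage (C : Set V)

/-- A convex projective domain is strictly convex if its boundary in projective space contains no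
(nondegenerate) projective line segment. A projective line segment is the image of a segment
`[v, w]` with `v`, `w` linearly independent. -/
structure IsStrictlyConvexProj (Ω : Set (ℙ ℝ V)) : Prop where
  convex : IsConvexProjDomain Ω
  no_segment : ∀ v w : V, LinearIndependent ℝ ![v, w] →
    ¬ projImage (segment ℝ v w) ⊆ frontier Ω

end Projective

/-- An affine domain `Ω ⊆ E` regarded as a subset of the projective space of `E × ℝ`, through the
affine chart `x ↦ [x : 1]`. -/
def toProj {E : Type*} [NormedAddCommGroup E] [NormedSpace ℝ E] (Ω : Set E) :
    Set (ℙ ℝ (E × ℝ)) :=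
  projImage ((fun x : E => (x, (1 : ℝ))) '' Ω)

end ConvexDomain

open Filter Topology Set

namespace ConvexDomain

/-! ### Asymptotic cones of convex domains -/

section Recession

variable {E : Type*} [NormedAddCommGroup E] [NormedSpace ℝ E] {Ω : Set E}

/-! Everything rests on rescaling (`exists_blowup`). Automorphisms bring any points `x k ∈ Ω` back
to a compact `K ⊆ Ω`, and proper convexity bounds the symmetric chords centred on `K`. Hence
directions `a k`, `b k` that fit symmetrically inside the closure at `x k` have bounded images, and
a limit gives `z ∈ Ω`, `α`, `β` such that `z + p • α + q • β` inherits what holds eventually for `x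
k + p • a k + q • b k`.

Four choices of `x k` suffice. Approaching a boundary point along a segment gives a nonzero
asymptotic direction. Approaching the midpoint of a maximal boundary segment gives a half-strip,
whose side is a boundary half-line. Running along a boundary half-line while approaching it gives a
quadrant, hence two independent asymptotic directions. Running to infinity inside a two-dimensional
asymptotic cone gives a sector whose edge is a boundary half-line. So the cone is never zero, and it
has dimension at least two exactly when the boundary contains a segment.

For the projective claim, limit points of `Ω` at infinity are asymptotic directions, so in the
strictly convex case there is only one. A projective boundary segment must then meet the affine
chart, where it yields an affine one. -/

theorem IsConvexDomain.mem_of_closure (h : IsConvexDomain Ω) {x y : E} (hx : x ∈ Ω)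
    (hy : y ∈ closure Ω) {t : ℝ} (ht : 0 < t) (ht1 : t ≤ 1) : y + t • (x - y) ∈ Ω := by
  have := h.convex.add_smul_sub_mem_interior' hy (by rwa [h.isOpen.interior_eq]) ⟨ht, ht1⟩
  rwa [h.isOpen.interior_eq] at this

theorem IsConvexDomain.closure_mem_of_closure (h : IsConvexDomain Ω) {x y : E}
    (hx : x ∈ closure Ω) (hy : y ∈ closure Ω) {t : ℝ} (ht : 0 ≤ t) (ht1 : t ≤ 1) :
    y + t • (x - y) ∈ closure Ω :=
  h.convex.closure.add_smul_sub_mem hy hx ⟨ht, ht1⟩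

/-- A direction along which some closed half-line stays in the closure is asymptotic. -/
theorem IsConvexDomain.mem_asympCone (h : IsConvexDomain Ω) {y u : E}
    (hu : ∀ t : ℝ, 0 ≤ t → y + t • u ∈ closure Ω) : u ∈ asympCone Ω := by
  have hy : y ∈ closure Ω := by simpa using hu 0 le_rfl
  have key : ∀ x ∈ Ω, ∀ t : ℝ, 0 ≤ t → x + t • u ∈ closure Ω := by
    intro x hx t ht
    have hlim : Tendsto (fun k : ℕ => x + (1 / ((k : ℝ) + 1)) • (y - x) + t • u) atTop
        (𝓝 (x + (0 : ℝ) • (y - x) + t • u)) := by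
      refine Tendsto.add_const _ (Tendsto.const_add _ (Tendsto.smul_const ?_ _))
      exact tendsto_one_div_add_atTop_nhds_zero_nat
    rw [zero_smul, add_zero] at hlim
    refine isClosed_closure.mem_of_tendsto hlim (Eventually.of_forall fun k => ?_)
    have hk : (0 : ℝ) < (k : ℝ) + 1 := by positivity
    -- Chords from `x` to ever farther points of the half-line become parallel to `u`.
    have := h.closure_mem_of_closure (hu (((k : ℝ) + 1) * t) (by positivity)) (subset_closure hx)
      (t := 1 / ((k : ℝ) + 1)) (by positivity) (by rw [div_le_one hk]; linarith [k.cast_nonneg (α := ℝ)])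
    convert this using 1
    match_scalars <;> field_simp
  intro x hx t ht
  have := h.mem_of_closure hx (key x hx (2 * t) (by positivity)) (t := 1 / 2) (by norm_num)
    (by norm_num)
  convert this using 1
  match_scalars <;> ring

theorem closure_add_mem {y u : E} (hy : y ∈ closure Ω)
    (hu : u ∈ asympCone Ω) : y + u ∈ closure Ω := by
  have hc : Continuous fun x : E => x + u := by fun_prop
  exact map_mem_closure (f := fun x : E => x + u) hc hy fun x hx => by
    simpa using hu x hx 1 zero_le_one

theorem asympCone_smul_mem {u : E} (hu : u ∈ asympCone Ω) {c : ℝ} (hc : 0 ≤ c) :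
    c • u ∈ asympCone Ω := by
  intro x hx t ht
  rw [smul_smul]
  exact hu x hx _ (by positivity)

theorem asympCone_add_mem {u v : E} (hu : u ∈ asympCone Ω) (hv : v ∈ asympCone Ω) :
    u + v ∈ asympCone Ω := by
  intro x hx t ht
  rw [smul_add, ← add_assoc]
  exact hv _ (hu x hx t ht) t ht

theorem IsConvexDomain.isClosed_asympCone (h : IsConvexDomain Ω) : IsClosed (asympCone Ω) := by
  obtain ⟨x, hx⟩ := h.nonempty
  have : asympCone Ω = ⋂ t : ℝ, ⋂ _ : 0 ≤ t, (fun u => x + t • u) ⁻¹' closure Ω := by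
    ext u
    simp only [mem_iInter, mem_preimage]
    exact ⟨fun hu t ht => subset_closure (hu x hx t ht), h.mem_asympCone⟩
  rw [this]
  exact isClosed_iInter fun t => isClosed_iInter fun _ =>
    isClosed_closure.preimage (by fun_prop)

theorem convex_asympCone : Convex ℝ (asympCone Ω) := fun _ hu _ hv _ _ ha hb _ =>
  asympCone_add_mem (asympCone_smul_mem hu ha) (asympCone_smul_mem hv hb)

theorem IsProperlyConvex.eq_zero_of_neg_mem (h : IsProperlyConvex Ω) {u : E}
    (hu : u ∈ asympCone Ω) (hu' : -u ∈ asympCone Ω) : u = 0 := by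
  by_contra h0
  obtain ⟨x, hx⟩ := h.nonempty
  refine h.no_line x u h0 fun t => ?_
  rcases le_total 0 t with ht | ht
  · exact hu x hx t ht
  · simpa using hu' x hx (-t) (by linarith)

/-- A half-line starting in a closed convex set either stays in it or has a last point there. -/
theorem exists_last_mem {F : Set E} (hF : IsClosed F) (hc : Convex ℝ F) {y w : E} (hy : y ∈ F) :
    (∀ t : ℝ, 0 ≤ t → y + t • w ∈ F) ∨
      ∃ T : ℝ, 0 ≤ T ∧ y + T • w ∈ F ∧ ∀ t, T < t → y + t • w ∉ F := by
  by_cases hall : ∀ t : ℝ, 0 ≤ t → y + t • w ∈ F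
  · exact Or.inl hall
  right
  push Not at hall
  obtain ⟨t₀, ht₀, hn⟩ := hall
  set S : Set ℝ := {t | 0 ≤ t ∧ y + t • w ∈ F}
  have hS : IsClosed S := isClosed_Ici.inter (hF.preimage (by fun_prop))
  have h0 : (0 : ℝ) ∈ S := ⟨le_rfl, by simpa using hy⟩
  have hb : ∀ t ∈ S, t ≤ t₀ := by
    intro t ht
    by_contra! hlt
    apply hn
    have hpos : 0 < t := ht₀.trans_lt hlt
    have := hc.add_smul_sub_mem hy ht.2 (t := t₀ / t)
      ⟨by positivity, by rw [div_le_one hpos]; exact hlt.le⟩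
    convert this using 1
    match_scalars <;> field_simp; ring
  have hm := hS.csSup_mem ⟨0, h0⟩ ⟨t₀, hb⟩
  refine ⟨sSup S, hm.1, hm.2, fun t ht htF => ?_⟩
  exact absurd (le_csSup ⟨t₀, hb⟩ (show t ∈ S from ⟨hm.1.trans ht.le, htF⟩)) (not_le.2 ht)

/-- The inverse of a group element carrying a point of `K` to `x` moves `x` into `K`. -/
theorem IsQuasiHomogeneous.exists_compact (hq : IsQuasiHomogeneous Ω) :
    ∃ K : Set E, IsCompact K ∧ K ⊆ Ω ∧ ∀ x ∈ Ω, ∃ g : E ≃ᵃ[ℝ] E,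
      (∀ y, g y ∈ Ω ↔ y ∈ Ω) ∧ g x ∈ K := by
  obtain ⟨-, K, hK, hKΩ, G, hG, hU⟩ := hq
  refine ⟨K, hK, hKΩ, fun x hx => ?_⟩
  rw [← hU] at hx
  simp only [mem_iUnion] at hx
  obtain ⟨g, hg, y, hy, rfl⟩ := hx
  have hgΩ : (g : E → E) '' Ω = Ω := hG hg
  refine ⟨g.symm, fun w => ⟨fun hw => ?_, fun hw => ?_⟩, by simpa using hy⟩
  · rw [← hgΩ]
    exact ⟨_, hw, by simp⟩
  · rw [← hgΩ] at hw
    obtain ⟨w', hw', rfl⟩ := hw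
    simpa using hw'

end Recession

/-! ### Rescaling by automorphisms -/

section BlowUp

variable {E : Type*} [NormedAddCommGroup E] [NormedSpace ℝ E] [FiniteDimensional ℝ E] {Ω : Set E}

/-- Over a compact subset of a properly convex domain, the symmetric chords are bounded. -/
theorem IsProperlyConvex.exists_chord_bound (h : IsProperlyConvex Ω) {K : Set E}
    (hK : IsCompact K) :
    ∃ M : ℝ, ∀ z ∈ K, ∀ w : E, z + w ∈ closure Ω → z - w ∈ closure Ω → ‖w‖ ≤ M := by
  have hd := h.toIsConvexDomain
  by_contra! hcon
  choose z hz w hw hw' hn using fun k : ℕ => hcon k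
  have hpos : ∀ k, 0 < ‖w k‖ := fun k => (Nat.cast_nonneg k).trans_lt (hn k)
  have hmem : ∀ k, (z k, ‖w k‖⁻¹ • w k) ∈ K ×ˢ Metric.sphere (0 : E) 1 := fun k =>
    ⟨hz k, by simp [norm_smul, (hpos k).ne']⟩
  have : ProperSpace E := FiniteDimensional.proper ℝ E
  obtain ⟨⟨z₀, d⟩, ⟨hz₀, hd1⟩, φ, hφ, hlim⟩ :=
    (hK.prod (isCompact_sphere (0 : E) 1)).tendsto_subseq hmem
  have hlz := (Prod.tendsto_iff _ _).1 hlim |>.1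
  have hld := (Prod.tendsto_iff _ _).1 hlim |>.2
  -- The half-lengths tend to infinity, so the limit chord is a complete line.
  have key : ∀ t : ℝ, z₀ + t • d ∈ closure Ω := by
    intro t
    refine isClosed_closure.mem_of_tendsto (hlz.add (hld.const_smul t)) ?_
    filter_upwards [hφ.tendsto_atTop.eventually (eventually_ge_atTop ⌈|t|⌉₊)] with k hk
    have h1 : |t| ≤ ‖w (φ k)‖ := (Nat.ceil_le.1 hk).trans (hn _).le
    have h2 := abs_le.1 h1
    have h3 := hpos (φ k)
    have := hd.closure_mem_of_closure (hw (φ k)) (hw' (φ k))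
      (t := (t / ‖w (φ k)‖ + 1) / 2)
      (by have : -1 ≤ t / ‖w (φ k)‖ := by rw [le_div_iff₀ h3]; linarith
          linarith)
      (by have : t / ‖w (φ k)‖ ≤ 1 := by rw [div_le_iff₀ h3]; linarith
          linarith)
    convert this using 1
    simp only [Function.comp]
    match_scalars <;> field_simp <;> ring
  have hd0 : d = 0 := h.eq_zero_of_neg_mem (hd.mem_asympCone fun t _ => key t)
    (hd.mem_asympCone (y := z₀) fun t _ => by simpa using key (-t))
  simp [hd0] at hd1

/-- The rescaling principle: moving the points `x k` back to a compact set, the domains seen from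
`x k` in the (bounded) directions `a k` and `b k` subconverge to the domain itself. -/
theorem IsProperlyConvex.exists_blowup (h : IsProperlyConvex Ω) (hq : IsQuasiHomogeneous Ω)
    {x a b : ℕ → E} (hx : ∀ k, x k ∈ Ω) {c : ℝ} (hc : 0 < c)
    (ha : ∀ k, x k + c • a k ∈ closure Ω) (ha' : ∀ k, x k - c • a k ∈ closure Ω)
    (hb : ∀ k, x k + c • b k ∈ closure Ω) (hb' : ∀ k, x k - c • b k ∈ closure Ω) :
    ∃ z ∈ Ω, ∃ α β : E,
      (∀ p q : ℝ, (∀ᶠ k in atTop, x k + p • a k + q • b k ∈ closure Ω) →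
        z + p • α + q • β ∈ closure Ω) ∧
      (∀ p q : ℝ, (∀ᶠ k in atTop, x k + p • a k + q • b k ∉ Ω) →
        z + p • α + q • β ∉ Ω) := by
  obtain ⟨K, hK, hKΩ, hg⟩ := hq.exists_compact
  choose g hgΩ hgK using fun k => hg (x k) (hx k)
  obtain ⟨M, hM⟩ := h.exists_chord_bound hK
  have hgc : ∀ k y, y ∈ closure Ω → g k y ∈ closure Ω := fun k y hy =>
    map_mem_closure (AffineMap.continuous_of_finiteDimensional (g k).toAffineMap) hy
      fun w hw => (hgΩ k w).2 hw
  have hmap : ∀ k w, g k (x k + w) = g k (x k) + (g k).linear w := fun k w => by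
    have := (g k).map_vadd (x k) w
    simpa [add_comm] using this
  -- The image under `g k` is a symmetric chord centred in `K`, of half-length at most `M`.
  have hbd : ∀ k w, x k + c • w ∈ closure Ω → x k - c • w ∈ closure Ω →
      (g k).linear w ∈ Metric.closedBall (0 : E) (M / c) := by
    intro k w h1 h2
    have h1' := hgc k _ h1
    have h2' := hgc k _ h2
    rw [hmap, map_smul] at h1'
    rw [sub_eq_add_neg, hmap, map_neg, map_smul, ← sub_eq_add_neg] at h2'
    have := hM _ (hgK k) _ h1' h2'
    rw [norm_smul, Real.norm_of_nonneg hc.le] at this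
    rw [mem_closedBall_zero_iff, le_div_iff₀ hc]
    linarith
  have : ProperSpace E := FiniteDimensional.proper ℝ E
  have hcb := isCompact_closedBall (0 : E) (M / c)
  obtain ⟨⟨z, α, β⟩, ⟨hz, -, -⟩, φ, hφ, hlim⟩ :=
    (hK.prod (hcb.prod hcb)).tendsto_subseq (x := fun k =>
      (g k (x k), (g k).linear (a k), (g k).linear (b k)))
      fun k => ⟨hgK k, hbd k _ (ha k) (ha' k), hbd k _ (hb k) (hb' k)⟩
  have hl1 := (Prod.tendsto_iff _ _).1 hlim |>.1
  have hl23 := (Prod.tendsto_iff _ _).1 hlim |>.2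
  have hl2 := (Prod.tendsto_iff _ _).1 hl23 |>.1
  have hl3 := (Prod.tendsto_iff _ _).1 hl23 |>.2
  have hL : ∀ p q : ℝ, Tendsto (fun k => g (φ k) (x (φ k) + p • a (φ k) + q • b (φ k))) atTop
      (𝓝 (z + p • α + q • β)) := by
    intro p q
    refine ((hl1.add (hl2.const_smul p)).add (hl3.const_smul q)).congr fun k => ?_
    simp only [Function.comp, add_assoc, hmap, map_add, map_smul]
  refine ⟨z, hKΩ hz, α, β, fun p q hpq => ?_, fun p q hpq => ?_⟩
  · exact isClosed_closure.mem_of_tendsto (hL p q)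
      ((hφ.tendsto_atTop.eventually hpq).mono fun k hk => hgc _ _ hk)
  · exact h.isOpen.isClosed_compl.mem_of_tendsto (hL p q)
      ((hφ.tendsto_atTop.eventually hpq).mono fun k hk hk' => hk ((hgΩ _ _).1 hk'))

end BlowUp

/-! ### Boundary segments, boundary half-lines and the asymptotic cone -/

section Affine

variable {E : Type*} [NormedAddCommGroup E] [NormedSpace ℝ E] {Ω : Set E}

theorem IsProperlyConvex.exists_notMem [Nontrivial E] (h : IsProperlyConvex Ω) :
    ∃ p ∈ closure Ω, p ∉ Ω := by
  obtain ⟨v, hv⟩ := exists_ne (0 : E)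
  obtain ⟨x, hx⟩ := h.nonempty
  have hn := h.no_line x v hv
  push Not at hn
  obtain ⟨t, ht⟩ := hn
  obtain ⟨p, hp⟩ := nonempty_frontier_iff.2 ⟨h.nonempty, fun hu => ht (hu ▸ mem_univ _)⟩
  rw [h.isOpen.frontier_eq] at hp
  exact ⟨p, hp.1, hp.2⟩

theorem exists_smul_eq_of_asymptoticDim_eq_one (h1 : asymptoticDim Ω = 1) {u v : E}
    (hu : u ∈ asympCone Ω) (hv : v ∈ asympCone Ω) (hu0 : u ≠ 0) : ∃ c : ℝ, c • u = v := by
  obtain ⟨c, hc⟩ := exists_smul_eq_of_finrank_eq_one h1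
    (x := (⟨u, Submodule.subset_span hu⟩ : Submodule.span ℝ (asympCone Ω)))
    (by simpa using hu0) ⟨v, Submodule.subset_span hv⟩
  exact ⟨c, congrArg Subtype.val hc⟩

variable [FiniteDimensional ℝ E]

/-- The asymptotic cone is nontrivial. -/
theorem IsProperlyConvex.exists_mem_asympCone_ne_zero [Nontrivial E] (h : IsProperlyConvex Ω)
    (hq : IsQuasiHomogeneous Ω) : ∃ u ∈ asympCone Ω, u ≠ 0 := by
  have hd := h.toIsConvexDomain
  obtain ⟨p, hp, hpn⟩ := h.exists_notMem
  obtain ⟨x₀, hx₀⟩ := h.nonempty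
  -- The shift by two keeps the doubled parameter at most one, so the symmetric chord stays between
  -- `p` and `x₀`.
  have hs0 : ∀ k : ℕ, (0 : ℝ) < 1 / ((k : ℝ) + 2) := fun k => by positivity
  have hs1 : ∀ k : ℕ, 1 / ((k : ℝ) + 2) ≤ 1 / 2 := fun k =>
    one_div_le_one_div_of_le two_pos (by linarith [k.cast_nonneg (α := ℝ)])
  have hin : ∀ t : ℝ, 0 ≤ t → t ≤ 1 → p + t • (x₀ - p) ∈ closure Ω := fun t ht ht1 =>
    hd.closure_mem_of_closure (subset_closure hx₀) hp ht ht1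
  have hpt : ∀ s r : ℝ, p + s • (x₀ - p) + r • s • (x₀ - p) = p + ((1 + r) * s) • (x₀ - p) :=
    fun s r => by match_scalars <;> ring
  obtain ⟨z, hz, α, β, h1, h2⟩ := h.exists_blowup hq
    (x := fun k => p + (1 / ((k : ℝ) + 2)) • (x₀ - p))
    (a := fun k => (1 / ((k : ℝ) + 2)) • (x₀ - p)) (b := fun _ => 0) (c := 1)
    (fun k => hd.mem_of_closure hx₀ hp (hs0 k) (by linarith [hs1 k])) one_pos
    (fun k => by
      rw [hpt]; exact hin _ (by linarith [hs0 k]) (by linarith [hs1 k]))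
    (fun k => by simpa using hp)
    (fun k => by simpa using hin _ (hs0 k).le (by linarith [hs1 k]))
    (fun k => by simpa using hin _ (hs0 k).le (by linarith [hs1 k]))
  refine ⟨α, hd.mem_asympCone (y := z) fun t ht => ?_, ?_⟩
  · have := h1 t 0 ?_
    · simpa using this
    · filter_upwards [eventually_ge_atTop ⌈t⌉₊] with k hk
      have hk' := Nat.ceil_le.1 hk
      have := hs0 k
      simp only [smul_zero, add_zero]
      rw [hpt]
      refine hin _ (by positivity) ?_
      rw [mul_one_div, div_le_one (by positivity)]
      linarith
  -- Parameter `-1` is the point `p ∉ Ω`, whereas `α = 0` would put its limit at `z ∈ Ω`.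
  · rintro rfl
    have := h2 (-1) 0 (Eventually.of_forall fun k => by simpa using hpn)
    simp [hz] at this

/-- A boundary segment of a quasi-homogeneous domain forces a boundary half-line. -/
theorem IsProperlyConvex.exists_ray_of_segment (h : IsProperlyConvex Ω)
    (hq : IsQuasiHomogeneous Ω) {a b : E} (hab : a ≠ b) (hs : segment ℝ a b ⊆ frontier Ω) :
    ∃ q u : E, u ≠ 0 ∧ ∀ r : ℝ, 0 ≤ r → q + r • u ∈ frontier Ω := by
  have hd := h.toIsConvexDomain
  rw [h.isOpen.frontier_eq] at hs ⊢
  have hseg : ∀ t : ℝ, 0 ≤ t → t ≤ 1 → a + t • (b - a) ∈ closure Ω \ Ω := fun t ht ht1 =>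
    hs (segment_eq_image' ℝ a b ▸ ⟨t, ⟨ht, ht1⟩, rfl⟩)
  -- A point of `Ω` beyond `b` would pull `b` into `Ω`, since `a` is in the closure.
  have hout : ∀ t : ℝ, 0 ≤ t → a + t • (b - a) ∉ Ω := by
    intro t ht hmem
    rcases le_or_gt t 1 with ht1 | ht1
    · exact (hseg t ht ht1).2 hmem
    · refine (hseg 1 zero_le_one le_rfl).2 ?_
      have := hd.mem_of_closure hmem (by simpa using (hseg 0 le_rfl zero_le_one).1) (t := 1 / t)
        (by positivity) (by rw [div_le_one (by linarith)]; exact ht1.le)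
      convert this using 1
      have : t ≠ 0 := by linarith
      match_scalars <;> field_simp; ring
  have haC : a ∈ closure Ω := by simpa using (hseg 0 le_rfl zero_le_one).1
  rcases exists_last_mem (w := b - a) isClosed_closure h.convex.closure haC with
    hall | ⟨T, hT0, hT, hTn⟩
  · exact ⟨a, b - a, sub_ne_zero.2 hab.symm, fun r hr => ⟨hall r hr, hout r hr⟩⟩
  have hT1 : 1 ≤ T := by
    by_contra! hlt
    exact hTn 1 hlt (hseg 1 zero_le_one le_rfl).1
  -- Midpoint and half-vector of the segment prolonged past `b` as far as the closure allows.
  obtain ⟨v, hv⟩ : ∃ v, v = (T / 2) • (b - a) := ⟨_, rfl⟩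
  obtain ⟨m, hm⟩ : ∃ m, m = a + (T / 2) • (b - a) := ⟨_, rfl⟩
  have hmv : ∀ r : ℝ, m + r • v = a + ((1 + r) * (T / 2)) • (b - a) := fun r => by
    rw [hm, hv]; match_scalars <;> ring
  have hmn : m ∉ Ω := hm ▸ hout _ (by linarith)
  have hmv1 : ∀ r : ℝ, |r| ≤ 1 → m + r • v ∈ closure Ω := by
    intro r hr
    have hr := abs_le.1 hr
    rw [hmv]
    have := hd.closure_mem_of_closure hT haC (t := (1 + r) / 2) (by linarith) (by linarith)
    convert this using 1
    match_scalars <;> ring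
  have hmvn : ∀ r : ℝ, 1 < r → m + r • v ∉ closure Ω := by
    intro r hr
    rw [hmv]
    exact hTn _ (by nlinarith)
  obtain ⟨x₀, hx₀⟩ := h.nonempty
  have hmC : m ∈ closure Ω := by simpa using hmv1 0 (by simp)
  obtain ⟨s, hs0, hs1, hs_lim⟩ : ∃ s : ℕ → ℝ, (∀ k, 0 < s k) ∧ (∀ k, s k ≤ 1 / 2) ∧
      Tendsto s atTop (𝓝 0) := by
    refine ⟨fun k => 1 / ((k + 1 : ℕ) + 1), fun k => by positivity, fun k => ?_, ?_⟩
    · exact one_div_le_one_div_of_le two_pos (by push_cast; linarith [k.cast_nonneg (α := ℝ)])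
    · exact (tendsto_add_atTop_iff_nat (f := fun n : ℕ => (1 : ℝ) / ((n : ℝ) + 1)) 1).2
        tendsto_one_div_add_atTop_nhds_zero_nat
  -- The triangle with vertices `m - v`, `m + v`, `x₀`.
  have hin : ∀ t r : ℝ, 0 ≤ t → t ≤ 1 → |r| ≤ 1 - t →
      m + t • (x₀ - m) + r • v ∈ closure Ω := by
    intro t r ht ht1 hr
    rcases ht1.eq_or_lt with rfl | hlt
    · have : r = 0 := by simpa using hr
      subst this
      simpa using subset_closure hx₀
    have hpos : 0 < 1 - t := by linarith
    have := hd.closure_mem_of_closure (subset_closure hx₀) (hmv1 (r / (1 - t))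
      (by rw [abs_div, abs_of_pos hpos, div_le_one hpos]; exact hr)) ht ht1
    convert this using 1
    match_scalars <;> field_simp; ring
  have hpt : ∀ s p r : ℝ, m + s • (x₀ - m) + p • s • (x₀ - m) + r • v =
      m + ((1 + p) * s) • (x₀ - m) + r • v :=
    fun s p r => by match_scalars <;> ring
  -- Only the transverse direction shrinks. Since `s k ≤ 1 / 2`, the triangle still has half-width
  -- `1 / 2` at `x k`, whence `c`.
  obtain ⟨z, hz, α, β, h1, h2⟩ := h.exists_blowup hq
    (x := fun k => m + s k • (x₀ - m)) (a := fun k => s k • (x₀ - m)) (b := fun _ => v)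
    (c := 1 / 2)
    (fun k => hd.mem_of_closure hx₀ hmC (hs0 k) (by linarith [hs1 k])) (by norm_num)
    (fun k => by
      have := hin ((1 + 1 / 2) * s k) 0 (by linarith [hs0 k]) (by linarith [hs1 k])
        (by rw [abs_zero]; linarith [hs1 k])
      rw [← hpt] at this
      simpa only [zero_smul, add_zero] using this)
    (fun k => by
      have := hin ((1 + -(1 / 2)) * s k) 0 (by linarith [hs0 k]) (by linarith [hs1 k, hs0 k])
        (by rw [abs_zero]; linarith [hs1 k, hs0 k])
      rw [← hpt] at this
      simpa only [zero_smul, add_zero, neg_smul, ← sub_eq_add_neg] using this)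
    (fun k => hin _ _ (hs0 k).le (by linarith [hs1 k])
      (by rw [abs_of_pos (by norm_num)]; linarith [hs1 k]))
    (fun k => by
      rw [sub_eq_add_neg, ← neg_smul]
      exact hin _ _ (hs0 k).le (by linarith [hs1 k])
        (by rw [abs_neg, abs_of_pos (by norm_num)]; linarith [hs1 k]))
  have hsp : ∀ p : ℝ, Tendsto (fun k => (1 + p) * s k) atTop (𝓝 0) := fun p => by
    simpa using hs_lim.const_mul (1 + p)
  have hray : ∀ p r : ℝ, -1 ≤ p → |r| < 1 → z + p • α + r • β ∈ closure Ω := by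
    intro p r hp hr
    refine h1 p r ?_
    filter_upwards [(hsp p).eventually (eventually_le_nhds (show (0 : ℝ) < 1 - |r| by linarith))]
      with k hk
    rw [hpt]
    exact hin _ _ (mul_nonneg (by linarith) (hs0 k).le) (by linarith [abs_nonneg r])
      (by linarith)
  have hray1 : ∀ p : ℝ, -1 ≤ p → z + p • α + (1 : ℝ) • β ∈ closure Ω := by
    intro p hp
    have hc : Continuous fun r : ℝ => z + p • α + r • β := by fun_prop
    have hlim := (hc.tendsto 1).comp
      (tendsto_one_div_add_atTop_nhds_zero_nat.const_sub (1 : ℝ) |>.trans (by rw [sub_zero]))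
    refine isClosed_closure.mem_of_tendsto hlim (Eventually.of_forall fun k => ?_)
    refine hray p _ hp ?_
    have h1 : (0 : ℝ) < 1 / ((k : ℝ) + 1) := by positivity
    have h2 : 1 / ((k : ℝ) + 1) ≤ 1 := by
      rw [div_le_one (by positivity)]; linarith [k.cast_nonneg (α := ℝ)]
    rw [abs_lt]
    constructor <;> linarith
  have hn : ∀ p r : ℝ, 1 < r → z + p • α + r • β ∉ Ω := by
    intro p r hr
    refine h2 p r ?_
    have hlim : Tendsto (fun k => m + ((1 + p) * s k) • (x₀ - m) + r • v) atTop
        (𝓝 (m + r • v)) := by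
      have := (((hsp p).smul_const (x₀ - m)).const_add m).add_const (r • v)
      simpa using this
    filter_upwards [hlim.eventually (isClosed_closure.isOpen_compl.mem_nhds (hmvn r hr))]
      with k hk hk'
    rw [hpt] at hk'
    exact hk (subset_closure hk')
  -- As `Ω` is open, exclusion for all `r > 1` passes to `r = 1`.
  have hn1 : ∀ p : ℝ, z + p • α + (1 : ℝ) • β ∉ Ω := by
    intro p hmem
    have hc : Continuous fun r : ℝ => z + p • α + r • β := by fun_prop
    have hnhds := (h.isOpen.preimage hc).mem_nhds (x := 1) hmem
    obtain ⟨r, hr, hr'⟩ := ((mem_nhdsWithin_of_mem_nhds hnhds :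
      _ ∈ 𝓝[>] (1 : ℝ)) |> fun h => (Filter.nonempty_of_mem (inter_mem h self_mem_nhdsWithin)))
    exact hn p r hr' hr
  refine ⟨z + (1 : ℝ) • β, α, ?_, fun r hr => ?_⟩
  · rintro rfl
    have := h2 (-1) 0 (Eventually.of_forall fun k => by simpa using hmn)
    simp [hz] at this
  · rw [add_right_comm]
    exact ⟨hray1 r (by linarith), hn1 r⟩

/-- A boundary half-line forces the asymptotic cone to have dimension at least two. -/
theorem IsProperlyConvex.exists_pair_of_ray (h : IsProperlyConvex Ω)
    (hq : IsQuasiHomogeneous Ω) {q u : E} (hu : u ≠ 0)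
    (hr : ∀ r : ℝ, 0 ≤ r → q + r • u ∈ frontier Ω) :
    ∃ α ∈ asympCone Ω, ∃ β ∈ asympCone Ω, α ≠ 0 ∧ ∀ c : ℝ, c • α ≠ β := by
  have hd := h.toIsConvexDomain
  rw [h.isOpen.frontier_eq] at hr
  have huC : u ∈ asympCone Ω := hd.mem_asympCone fun t ht => (hr t ht).1
  obtain ⟨x₀, hx₀⟩ := h.nonempty
  have hqC : q ∈ closure Ω := by simpa using (hr 0 le_rfl).1
  have hin : ∀ t s : ℝ, 0 ≤ t → 0 ≤ s → s ≤ 1 → q + t • u + s • (x₀ - q) ∈ closure Ω := by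
    intro t s ht hs hs1
    rw [add_right_comm]
    exact closure_add_mem (hd.closure_mem_of_closure (subset_closure hx₀) hqC hs hs1)
      (asympCone_smul_mem huC ht)
  have hinΩ : ∀ t s : ℝ, 0 ≤ t → 0 < s → s ≤ 1 → q + t • u + s • (x₀ - q) ∈ Ω := by
    intro t s ht hs hs1
    rw [add_right_comm]
    exact huC _ (hd.mem_of_closure hx₀ hqC hs hs1) t ht
  obtain ⟨n, hn, hn'⟩ : ∃ n : ℕ → ℝ, (∀ k, 2 ≤ n k) ∧ Tendsto n atTop atTop :=
    ⟨fun k => k + 2, fun k => by linarith [k.cast_nonneg (α := ℝ)],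
      tendsto_atTop_add_const_right _ _ tendsto_natCast_atTop_atTop⟩
  have hpt : ∀ n p r : ℝ, q + n • u + (1 / n) • (x₀ - q) + p • n • u + r • (1 / n) • (x₀ - q) =
      q + ((1 + p) * n) • u + ((1 + r) / n) • (x₀ - q) :=
    fun n p r => by match_scalars <;> ring
  have hin' : ∀ k, ∀ p r : ℝ, |p| ≤ 1 → |r| ≤ 1 →
      q + n k • u + (1 / n k) • (x₀ - q) + p • n k • u + r • (1 / n k) • (x₀ - q) ∈
        closure Ω := by
    intro k p r hp hr
    have hp := abs_le.1 hp
    have hr := abs_le.1 hr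
    have h2 := hn k
    rw [hpt]
    exact hin _ _ (mul_nonneg (by linarith) (by linarith))
      (div_nonneg (by linarith) (by linarith)) (by rw [div_le_one (by linarith)]; linarith)
  -- The base point recedes by `n k` along the half-line and comes within `1 / n k` of it; scaling
  -- by these amounts turns the half-strip into a quadrant.
  obtain ⟨z, hz, α, β, h1, h2⟩ := h.exists_blowup hq
    (x := fun k => q + n k • u + (1 / n k) • (x₀ - q)) (a := fun k => n k • u)
    (b := fun k => (1 / n k) • (x₀ - q)) (c := 1)
    (fun k => hinΩ _ _ (by linarith [hn k]) (by have := hn k; positivity)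
      (by rw [div_le_one (by linarith [hn k])]; linarith [hn k])) one_pos
    (fun k => by simpa using hin' k 1 0 (by simp) (by simp))
    (fun k => by
      simpa only [zero_smul, add_zero, neg_smul, one_smul, ← sub_eq_add_neg] using
        hin' k (-1) 0 (by simp) (by simp))
    (fun k => by simpa using hin' k 0 1 (by simp) (by simp))
    (fun k => by
      simpa only [zero_smul, add_zero, neg_smul, one_smul, ← sub_eq_add_neg] using
        hin' k 0 (-1) (by simp) (by simp))
  have hquad : ∀ p r : ℝ, -1 ≤ p → -1 ≤ r → z + p • α + r • β ∈ closure Ω := by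
    intro p r hp hr
    refine h1 p r ?_
    filter_upwards [hn'.eventually (eventually_ge_atTop (1 + r))] with k hk
    have := hn k
    rw [hpt]
    exact hin _ _ (mul_nonneg (by linarith) (by linarith))
      (div_nonneg (by linarith) (by linarith)) (by rw [div_le_one (by linarith)]; linarith)
  have hα : α ∈ asympCone Ω := hd.mem_asympCone (y := z) fun t ht => by
    simpa using hquad t 0 (by linarith) (by norm_num)
  have hβ : β ∈ asympCone Ω := hd.mem_asympCone (y := z) fun t ht => by
    simpa using hquad 0 t (by norm_num) (by linarith)
  have hside : z - β ∉ Ω := by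
    have := h2 0 (-1) (Eventually.of_forall fun k => by
      have := hn k
      rw [hpt]
      simpa using (hr (n k) (by linarith)).2)
    simpa [sub_eq_add_neg] using this
  have hβ0 : β ≠ 0 := by
    rintro rfl
    simp [hz] at hside
  have hbelow : ∃ c : ℝ, 0 < c ∧ q - c • u ∉ closure Ω := by
    by_contra! hcon
    refine hu (h.eq_zero_of_neg_mem huC (hd.mem_asympCone (y := q) fun t ht => ?_))
    rcases ht.eq_or_lt with rfl | ht
    · simpa using hqC
    · simpa [sub_eq_add_neg] using hcon t ht
  -- For `α = 0`, parameter `-2` would give `z` again. It comes from points near `q - n k • u`,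
  -- behind `q`; were they in `Ω`, contracting them towards `q` by `c / n k` would give points of
  -- the closure tending to `q - c • u`, which lies outside it.
  have hα0 : α ≠ 0 := by
    rintro rfl
    have := h2 (-2) 0 ?_
    · simp [hz] at this
    obtain ⟨c, hc, hcn⟩ := hbelow
    have hlim : Tendsto (fun k => q - c • u + (c / n k * (1 / n k)) • (x₀ - q)) atTop
        (𝓝 (q - c • u)) := by
      have h0 : Tendsto (fun k => c / n k * (1 / n k)) atTop (𝓝 (0 * 0)) :=
        (hn'.const_div_atTop c).mul (hn'.const_div_atTop 1)
      have := (h0.smul_const (x₀ - q)).const_add (q - c • u)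
      simpa using this
    filter_upwards [hlim.eventually (isClosed_closure.isOpen_compl.mem_nhds hcn),
      hn'.eventually (eventually_ge_atTop c)] with k hk hck hmem
    have h2k := hn k
    have hpos : 0 < n k := by linarith
    rw [hpt] at hmem
    refine hk ?_
    have := hd.closure_mem_of_closure (subset_closure hmem) hqC (t := c / n k) (by positivity)
      (by rw [div_le_one hpos]; exact hck)
    convert this using 1
    match_scalars <;> field_simp <;> ring
  refine ⟨α, hα, β, hβ, hα0, ?_⟩
  rintro c rfl
  rcases le_or_gt c 0 with hc | hc
  · refine hβ0 (h.eq_zero_of_neg_mem hβ ?_)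
    rw [← neg_smul]
    exact asympCone_smul_mem hα (by linarith)
  -- For `β = c • α` with `c > 0`, the point `z - β` lies strictly between the corner `z - α - β`
  -- and `z`.
  · apply hside
    have := hd.mem_of_closure hz (hquad (-1) (-1) le_rfl le_rfl) (t := 1 / (1 + c))
      (by positivity) (by rw [div_le_one (by linarith)]; linarith)
    convert this using 1
    match_scalars <;> field_simp <;> ring

/-- If the asymptotic cone has dimension at least two, the boundary contains a half-line. -/
theorem IsProperlyConvex.exists_ray_of_pair (h : IsProperlyConvex Ω)
    (hq : IsQuasiHomogeneous Ω) {u v : E} (hu : u ∈ asympCone Ω) (hv : v ∈ asympCone Ω)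
    (hu0 : u ≠ 0) (huv : ∀ c : ℝ, c • u ≠ v) :
    ∃ q w : E, w ≠ 0 ∧ ∀ r : ℝ, 0 ≤ r → q + r • w ∈ frontier Ω := by
  have hd := h.toIsConvexDomain
  -- Moving from `v` in direction `-u` must leave the cone, since otherwise `-u` would be
  -- asymptotic; the last point `w` spans an edge of the planar section.
  obtain ⟨w, hw, hw0, hwn⟩ : ∃ w ∈ asympCone Ω, w ≠ 0 ∧
      ∀ ε : ℝ, 0 < ε → w - ε • u ∉ asympCone Ω := by
    obtain ⟨x, hx⟩ := h.nonempty
    rcases exists_last_mem (w := -u) hd.isClosed_asympCone convex_asympCone hv with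
      hall | ⟨T, -, hT, hTn⟩
    · refine absurd (h.eq_zero_of_neg_mem hu (hd.mem_asympCone (y := x + v) fun t ht => ?_)) hu0
      have := hall t ht x hx 1 zero_le_one
      rw [one_smul, ← add_assoc] at this
      exact subset_closure this
    · refine ⟨v + T • -u, hT, fun h0 => huv T ?_, fun ε hε hmem => hTn (T + ε) (by linarith) ?_⟩
      · rw [smul_neg, ← sub_eq_add_neg, sub_eq_zero] at h0
        exact h0.symm
      · convert hmem using 1
        match_scalars <;> ring
  have hin : ∀ p r : ℝ, 0 ≤ p → 0 ≤ p + r → p • (u + w) + r • w ∈ asympCone Ω := by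
    intro p r hp hr
    have := asympCone_add_mem (asympCone_smul_mem hu hp) (asympCone_smul_mem hw hr)
    convert this using 1
    match_scalars <;> ring
  have hs0 : u + w ≠ 0 := fun h0 => hu0 (h.eq_zero_of_neg_mem hu (by
    rwa [← eq_neg_of_add_eq_zero_right h0]))
  obtain ⟨x, hx⟩ := h.nonempty
  obtain ⟨n, hn, hn'⟩ : ∃ n : ℕ → ℝ, (∀ k, 1 ≤ n k) ∧ Tendsto n atTop atTop :=
    ⟨fun k => k + 1, fun k => by linarith [k.cast_nonneg (α := ℝ)],
      tendsto_atTop_add_const_right _ _ tendsto_natCast_atTop_atTop⟩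
  have hpt : ∀ n p r : ℝ, x + n • (u + w) + p • n • (u + w) + r • n • w =
      x + n • ((1 + p) • (u + w) + r • w) := fun n p r => by match_scalars <;> ring
  have hin' : ∀ k, ∀ p r : ℝ, 0 ≤ 1 + p → 0 ≤ 1 + p + r →
      x + n k • (u + w) + p • n k • (u + w) + r • n k • w ∈ closure Ω := by
    intro k p r hp hr
    rw [hpt]
    exact subset_closure (hin _ _ hp hr x hx _ (by linarith [hn k]))
  obtain ⟨z, hz, α, β, h1, h2⟩ := h.exists_blowup hq
    (x := fun k => x + n k • (u + w)) (a := fun k => n k • (u + w))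
    (b := fun k => n k • w) (c := 1)
    (fun k => asympCone_add_mem hu hw x hx _ (by linarith [hn k])) one_pos
    (fun k => by simpa using hin' k 1 0 (by norm_num) (by norm_num))
    (fun k => by
      simpa only [zero_smul, add_zero, neg_smul, one_smul, ← sub_eq_add_neg] using
        hin' k (-1) 0 (by norm_num) (by norm_num))
    (fun k => by simpa using hin' k 0 1 (by norm_num) (by norm_num))
    (fun k => by
      simpa only [zero_smul, add_zero, neg_smul, one_smul, ← sub_eq_add_neg] using
        hin' k 0 (-1) (by norm_num) (by norm_num))
  -- A half-line from `x` in a non-asymptotic direction leaves the closure at finite time, and `n k`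
  -- passes that time.
  have hout : ∀ p r : ℝ, (1 + p) • (u + w) + r • w ∉ asympCone Ω → z + p • α + r • β ∉ Ω := by
    intro p r hn0
    refine h2 p r ?_
    rcases exists_last_mem (w := (1 + p) • (u + w) + r • w) isClosed_closure h.convex.closure
      (subset_closure hx) with hall | ⟨T, -, -, hT⟩
    · exact absurd (hd.mem_asympCone hall) hn0
    filter_upwards [hn'.eventually (eventually_gt_atTop T)] with k hk hmem
    rw [hpt] at hmem
    exact hT _ hk (subset_closure hmem)
  -- Parameters `p = -1`, `r ≥ 0` correspond to the edge directions `r • w`. If `β = 0`, every `u +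
  -- w - t • w` would be asymptotic, forcing `w = 0`.
  refine ⟨z - α, β, ?_, fun r hr => ?_⟩
  · rintro rfl
    refine hw0 (h.eq_zero_of_neg_mem hw (hd.mem_asympCone (y := x + (u + w)) fun t ht => ?_))
    by_contra hcon
    refine hout 0 (-t) (fun hmem => hcon ?_) (by simpa using hz)
    have := subset_closure (hmem x hx 1 zero_le_one)
    convert this using 1
    match_scalars <;> ring
  · rw [h.isOpen.frontier_eq]
    refine ⟨?_, fun hmem => ?_⟩
    · have := h1 (-1) r (Eventually.of_forall fun k => hin' k _ _ (by norm_num) (by linarith))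
      simpa [sub_eq_add_neg] using this
    -- Openness allows `p = -s` with `s > 1`; adding `(s - 1) • w` to the resulting asymptotic
    -- direction gives `r • w - (s - 1) • u`, beyond the edge.
    · have hc : Continuous fun s : ℝ => z - s • α + r • β := by fun_prop
      have hnhds := (h.isOpen.preimage hc).mem_nhds (x := 1) (by simpa using hmem)
      obtain ⟨s, hs, hs'⟩ := Filter.nonempty_of_mem (inter_mem
        (mem_nhdsWithin_of_mem_nhds hnhds : _ ∈ 𝓝[>] (1 : ℝ)) self_mem_nhdsWithin)
      have hs'' : 1 < s := hs'
      refine hout (-s) r (fun hC => ?_) (by simpa [sub_eq_add_neg] using hs)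
      have hsum := asympCone_add_mem hC (asympCone_smul_mem hw (sub_nonneg.2 hs''.le))
      rcases hr.eq_or_lt with rfl | hr
      · refine hwn (s - 1) (by linarith) ?_
        convert asympCone_add_mem hsum hw using 1
        match_scalars <;> ring
      · refine hwn ((s - 1) / r) (div_pos (by linarith) hr) ?_
        convert asympCone_smul_mem hsum (inv_nonneg.2 hr.le) using 1
        match_scalars <;> field_simp <;> ring

theorem IsProperlyConvex.not_isStrictlyConvex_of_pair (h : IsProperlyConvex Ω)
    (hq : IsQuasiHomogeneous Ω) {u v : E} (hu : u ∈ asympCone Ω) (hv : v ∈ asympCone Ω)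
    (hu0 : u ≠ 0) (huv : ∀ c : ℝ, c • u ≠ v) : ¬ IsStrictlyConvex Ω := by
  intro hs
  obtain ⟨q, w, hw, hr⟩ := h.exists_ray_of_pair hq hu hv hu0 huv
  refine hs.no_segment q (q + w) (by simpa using hw) ?_
  rw [segment_eq_image']
  rintro - ⟨t, ht, rfl⟩
  simpa using hr t ht.1

theorem IsProperlyConvex.asymptoticDim_eq_one [Nontrivial E] (h : IsProperlyConvex Ω)
    (hq : IsQuasiHomogeneous Ω) (hs : IsStrictlyConvex Ω) : asymptoticDim Ω = 1 := by
  obtain ⟨u, hu, hu0⟩ := h.exists_mem_asympCone_ne_zero hq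
  have : Submodule.span ℝ (asympCone Ω) = Submodule.span ℝ {u} := by
    refine le_antisymm (Submodule.span_le.2 fun v hv => ?_)
      (Submodule.span_mono (singleton_subset_iff.2 hu))
    by_contra hcon
    refine h.not_isStrictlyConvex_of_pair hq hu hv hu0 (fun c hc => hcon ?_) hs
    exact Submodule.mem_span_singleton.2 ⟨c, hc⟩
  rw [asymptoticDim, this, finrank_span_singleton hu0]

theorem IsProperlyConvex.isStrictlyConvex_of_asymptoticDim (h : IsProperlyConvex Ω)
    (hq : IsQuasiHomogeneous Ω) (h1 : asymptoticDim Ω = 1) : IsStrictlyConvex Ω := by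
  refine ⟨h.toIsConvexDomain, fun a b hab hs => ?_⟩
  obtain ⟨q, u, hu, hr⟩ := h.exists_ray_of_segment hq hab hs
  obtain ⟨α, hα, β, hβ, hα0, hn⟩ := h.exists_pair_of_ray hq hu hr
  obtain ⟨c, hc⟩ := exists_smul_eq_of_asymptoticDim_eq_one h1 hα hβ hα0
  exact hn c hc

end Affine

/-! ### Lifting projective sets to vectors -/

section Projective

variable {V : Type*} [AddCommGroup V] [Module ℝ V]

theorem mk_mem_projImage {S : Set V} {v : V} (hv : v ≠ 0) :
    Projectivization.mk ℝ v hv ∈ projImage S ↔ ∃ c : ℝ, c ≠ 0 ∧ c • v ∈ S := by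
  constructor
  · rintro ⟨w, hw, hwS, heq⟩
    obtain ⟨c, hc⟩ := (Projectivization.mk_eq_mk_iff ℝ _ _ hw hv).1 heq.symm
    exact ⟨c, c.ne_zero, by rw [← Units.smul_def, hc]; exact hwS⟩
  · rintro ⟨c, hc, hcS⟩
    refine ⟨c • v, smul_ne_zero hc hv, hcS, ?_⟩
    exact (Projectivization.mk_eq_mk_iff ℝ _ _ _ _).2 ⟨(Units.mk0 c hc)⁻¹, by
      rw [Units.smul_def]; simp [smul_smul, hc]⟩

variable [TopologicalSpace V]

theorem isOpen_projective_iff {U : Set (ℙ ℝ V)} :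
    IsOpen U ↔ IsOpen {v : {v : V // v ≠ 0} | Projectivization.mk ℝ v.1 v.2 ∈ U} :=
  isOpen_coinduced

end Projective

/-! ### Cones over affine domains and the boundary at infinity -/

section Homogenization

variable {E : Type*} [NormedAddCommGroup E] [NormedSpace ℝ E] {Ω : Set E}

/-- The open cone over an affine domain placed at height one. -/
def coneOver (Ω : Set E) : Set (E × ℝ) := {p | 0 < p.2 ∧ p.2⁻¹ • p.1 ∈ Ω}

theorem isOpen_coneOver (h : IsOpen Ω) : IsOpen (coneOver Ω) := by
  have hU : IsOpen {p : E × ℝ | 0 < p.2} := isOpen_lt continuous_const continuous_snd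
  have hc : ContinuousOn (fun p : E × ℝ => p.2⁻¹ • p.1) {p : E × ℝ | 0 < p.2} :=
    (continuousOn_snd.inv₀ fun p hp => (show (0 : ℝ) < p.2 from hp).ne').smul continuousOn_fst
  exact hc.isOpen_inter_preimage hU h

theorem smul_mem_coneOver {p : E × ℝ} (hp : p ∈ coneOver Ω) {c : ℝ} (hc : 0 < c) :
    c • p ∈ coneOver Ω := by
  refine ⟨mul_pos hc hp.1, ?_⟩
  convert hp.2 using 1
  have := hp.1.ne'
  simp only [Prod.smul_snd, Prod.smul_fst, smul_eq_mul, smul_smul]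
  congr 1
  field_simp

theorem IsConvexDomain.add_mem_coneOver (h : IsConvexDomain Ω) {p q : E × ℝ}
    (hp : p ∈ coneOver Ω) (hq : q ∈ coneOver Ω) : p + q ∈ coneOver Ω := by
  have hp1 := hp.1
  have hq1 := hq.1
  refine ⟨add_pos hp1 hq1, ?_⟩
  have := h.convex hp.2 hq.2 (a := p.2 / (p.2 + q.2)) (b := q.2 / (p.2 + q.2)) (by positivity)
    (by positivity) (by field_simp)
  convert this using 1
  simp only [Prod.fst_add, Prod.snd_add]
  match_scalars <;> field_simp

theorem mk_mem_toProj {v : E × ℝ} (hv : v ≠ 0) :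
    Projectivization.mk ℝ v hv ∈ toProj Ω ↔ v ∈ coneOver Ω ∨ -v ∈ coneOver Ω := by
  rw [toProj, mk_mem_projImage]
  constructor
  · rintro ⟨c, hc, x, hx, hxv⟩
    have h1 : c • v.1 = x := (congrArg Prod.fst hxv).symm
    have h2 : c * v.2 = 1 := (congrArg Prod.snd hxv).symm
    have h3 : c = v.2⁻¹ := eq_inv_of_mul_eq_one_left h2
    rcases hc.lt_or_gt with hc | hc
    · refine Or.inr ⟨?_, ?_⟩
      · simp only [Prod.snd_neg]; nlinarith
      · simpa [← h3, inv_neg, h1] using hx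
    · refine Or.inl ⟨?_, ?_⟩
      · by_contra! hle; nlinarith
      · rwa [← h3, h1]
  · rintro (h | h)
    · exact ⟨v.2⁻¹, inv_ne_zero h.1.ne', _, h.2, by ext <;> simp [h.1.ne']⟩
    · have h1 := h.1
      have h2 := h.2
      simp only [Prod.snd_neg, Prod.fst_neg, inv_neg, smul_neg, neg_smul, neg_neg] at h1 h2
      have h0 : v.2 ≠ 0 := by linarith
      exact ⟨v.2⁻¹, inv_ne_zero h0, _, h2, by ext <;> simp [h0]⟩

theorem isOpen_toProj (h : IsOpen Ω) : IsOpen (toProj Ω) := by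
  rw [isOpen_projective_iff]
  simp only [mk_mem_toProj]
  have ho := isOpen_coneOver h
  exact (ho.preimage continuous_subtype_val).union (ho.preimage continuous_subtype_val.neg)

theorem IsConvexDomain.isConvexProjDomain_toProj (h : IsConvexDomain Ω) :
    IsConvexProjDomain (toProj Ω) := by
  let C : ConvexCone ℝ (E × ℝ) :=
    { carrier := coneOver Ω
      smul_mem' := fun _ hc _ hp => smul_mem_coneOver hp hc
      add_mem' := fun _ hp _ hq => h.add_mem_coneOver hp hq }
  obtain ⟨x, hx⟩ := h.nonempty
  refine ⟨C, ⟨(x, 1), one_pos, by simpa using hx⟩, isOpen_coneOver h.isOpen,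
    fun h0 => lt_irrefl _ h0.1, ?_⟩
  ext p
  induction p with
  | h v hv =>
    rw [mk_mem_toProj, mk_mem_projImage]
    constructor
    · rintro (h | h)
      · exact ⟨1, one_ne_zero, by rwa [one_smul]⟩
      · exact ⟨-1, by norm_num, by rwa [neg_one_smul]⟩
    · rintro ⟨c, hc, hcv⟩
      rcases hc.lt_or_gt with hc | hc
      · right
        have := smul_mem_coneOver hcv (inv_pos.2 (neg_pos.2 hc))
        rwa [smul_smul, inv_neg, neg_mul, inv_mul_cancel₀ hc.ne, neg_one_smul] at this
      · left
        have := smul_mem_coneOver hcv (inv_pos.2 hc)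
        rwa [smul_smul, inv_mul_cancel₀ hc.ne', one_smul] at this

/-- The complement of the closed cone and its negative is open and invariant under nonzero scaling,
so it descends to an open projective set disjoint from `toProj Ω`. -/
theorem mem_closure_coneOver_of_mk_mem {v : E × ℝ} (hv : v ≠ 0)
    (hmem : Projectivization.mk ℝ v hv ∈ closure (toProj Ω)) :
    v ∈ closure (coneOver Ω) ∨ -v ∈ closure (coneOver Ω) := by
  by_contra! hcon
  set U : Set (ℙ ℝ (E × ℝ)) :=
    {p | ¬ (p.rep ∈ closure (coneOver Ω) ∨ -p.rep ∈ closure (coneOver Ω))}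
  have hsmul : ∀ c : ℝ, 0 < c → ∀ p ∈ closure (coneOver Ω), c • p ∈ closure (coneOver Ω) :=
    fun c hc p hp => map_mem_closure (f := fun p : E × ℝ => c • p) (by fun_prop) hp
      fun q hq => smul_mem_coneOver hq hc
  have hpm : ∀ c : ℝ, c ≠ 0 → ∀ p : E × ℝ,
      p ∈ closure (coneOver Ω) ∨ -p ∈ closure (coneOver Ω) →
      c • p ∈ closure (coneOver Ω) ∨ -(c • p) ∈ closure (coneOver Ω) := by
    intro c hc p hp
    rcases hc.lt_or_gt with hc | hc
    · have := hsmul (-c) (by linarith)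
      rcases hp with hp | hp
      · exact Or.inr (by simpa using this _ hp)
      · exact Or.inl (by simpa using this _ hp)
    · exact hp.imp (hsmul c hc _) fun hp => by simpa using hsmul c hc _ hp
  have hU : ∀ (w : E × ℝ) (hw : w ≠ 0), Projectivization.mk ℝ w hw ∈ U ↔
      ¬ (w ∈ closure (coneOver Ω) ∨ -w ∈ closure (coneOver Ω)) := by
    intro w hw
    obtain ⟨c, hc⟩ := Projectivization.exists_smul_eq_mk_rep ℝ w hw
    rw [Units.smul_def] at hc
    simp only [U, mem_ofPred_eq, ← hc]
    refine not_congr ⟨fun h => ?_, hpm _ c.ne_zero _⟩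
    have := hpm _ (inv_ne_zero c.ne_zero) _ h
    simpa only [smul_smul, inv_mul_cancel₀ c.ne_zero, one_smul] using this
  have hUo : IsOpen U := by
    rw [isOpen_projective_iff]
    simp only [hU, not_or]
    have ho := (isClosed_closure (s := coneOver Ω)).isOpen_compl
    exact (ho.preimage continuous_subtype_val).inter (ho.preimage continuous_subtype_val.neg)
  obtain ⟨p, hpU, hpΩ⟩ := mem_closure_iff.1 hmem U hUo ((hU v hv).2 (not_or.2 hcon))
  induction p with
  | h w hw =>
    rw [hU] at hpU
    rw [mk_mem_toProj] at hpΩ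
    exact hpU (hpΩ.imp (fun h => subset_closure h) fun h => subset_closure h)

theorem mem_closure_of_mem_closure_coneOver {v : E × ℝ} (hv : v ∈ closure (coneOver Ω))
    (h0 : v.2 ≠ 0) : v.2⁻¹ • v.1 ∈ closure Ω := by
  have hc : ContinuousAt (fun p : E × ℝ => p.2⁻¹ • p.1) v :=
    (continuousAt_snd.inv₀ h0).smul continuousAt_fst
  exact closure_mono (image_subset_iff.2 fun p hp => hp.2)
    (hc.continuousWithinAt.mem_closure_image hv)

/-- Adding nonnegative multiples of `(y, 0)` to `(x, 1)` stays in the closed cone at height one,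
which traces a half-line in `closure Ω`. -/
theorem IsConvexDomain.mem_asympCone_of_mem_closure_coneOver (h : IsConvexDomain Ω) {y : E}
    (hy : (y, (0 : ℝ)) ∈ closure (coneOver Ω)) : y ∈ asympCone Ω := by
  obtain ⟨x, hx⟩ := h.nonempty
  refine h.mem_asympCone (y := x) fun t ht => ?_
  rcases ht.eq_or_lt with rfl | ht
  · simpa using subset_closure hx
  have hx' : (x, (1 : ℝ)) ∈ coneOver Ω := ⟨one_pos, by simpa using hx⟩
  have hmap : (x, (1 : ℝ)) + t • (y, (0 : ℝ)) ∈ closure (coneOver Ω) :=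
    map_mem_closure (f := fun p : E × ℝ => (x, (1 : ℝ)) + t • p) (by fun_prop) hy
      fun p hp => h.add_mem_coneOver hx' (smul_mem_coneOver hp ht)
  simpa using mem_closure_of_mem_closure_coneOver hmap (by simp)

theorem mem_frontier_of_mk_mem_frontier (h : IsOpen Ω) {v : E × ℝ} (hv : v ≠ 0) (h0 : v.2 ≠ 0)
    (hmem : Projectivization.mk ℝ v hv ∈ frontier (toProj Ω)) :
    v.2⁻¹ • v.1 ∈ frontier Ω := by
  rw [(isOpen_toProj h).frontier_eq] at hmem
  rw [h.frontier_eq]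
  refine ⟨?_, fun hΩ => hmem.2 ?_⟩
  · rcases mem_closure_coneOver_of_mk_mem hv hmem.1 with h | h
    · exact mem_closure_of_mem_closure_coneOver h h0
    · simpa using mem_closure_of_mem_closure_coneOver h (by simpa using h0)
  · rw [mk_mem_toProj]
    rcases h0.lt_or_gt with h0 | h0
    · exact Or.inr ⟨by simpa using h0, by simpa using hΩ⟩
    · exact Or.inl ⟨h0, hΩ⟩

/-- A projective segment in the boundary meeting the affine chart at an end point contains a
nondegenerate affine boundary segment. -/
theorem IsStrictlyConvex.not_projImage_segment_subset (hs : IsStrictlyConvex Ω) {v w : E × ℝ}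
    (hlin : LinearIndependent ℝ ![v, w]) (hv0 : v.2 ≠ 0) :
    ¬ projImage (segment ℝ v w) ⊆ frontier (toProj Ω) := by
  intro hsub
  rw [LinearIndependent.pair_iff] at hlin
  have hne : ∀ a b : ℝ, a ≠ 0 ∨ b ≠ 0 → a • v + b • w ≠ 0 := fun a b hab h0 => by
    have := hlin a b h0
    tauto
  have hfr : ∀ a b : ℝ, 0 ≤ a → 0 ≤ b → a + b = 1 → (a • v + b • w).2 ≠ 0 →
      (a • v + b • w).2⁻¹ • (a • v + b • w).1 ∈ frontier Ω := by
    intro a b ha hb hab h0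
    have hab0 : a • v + b • w ≠ 0 := fun h => h0 (by rw [h]; rfl)
    exact mem_frontier_of_mk_mem_frontier hs.isOpen hab0 h0
      (hsub ⟨_, hab0, ⟨a, b, ha, hb, hab, rfl⟩, rfl⟩)
  -- For small `ε` the height keeps the sign of `v.2`, so this initial piece of the segment avoids
  -- infinity.
  obtain ⟨ε, hε0, hε1, hε⟩ : ∃ ε : ℝ, 0 < ε ∧ ε < 1 ∧ 0 < ((1 - ε) * v.2 + ε * w.2) * v.2 := by
    have hc : Continuous fun ε : ℝ => ((1 - ε) * v.2 + ε * w.2) * v.2 := by fun_prop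
    have hnhds : ∀ᶠ ε in 𝓝[>] (0 : ℝ), 0 < ((1 - ε) * v.2 + ε * w.2) * v.2 :=
      mem_nhdsWithin_of_mem_nhds ((isOpen_lt continuous_const hc).mem_nhds (by
        simpa using hv0))
    obtain ⟨ε, h1, h2⟩ := (hnhds.and (Ioo_mem_nhdsGT one_pos)).exists
    exact ⟨ε, h2.1, h2.2, h1⟩
  obtain ⟨τ, hτ⟩ : ∃ τ, τ = (1 - ε) * v.2 + ε * w.2 := ⟨_, rfl⟩
  rw [← hτ] at hε
  have hτ0 : τ ≠ 0 := left_ne_zero_of_mul hε.ne'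
  refine hs.no_segment (v.2⁻¹ • v.1) (τ⁻¹ • ((1 - ε) • v.1 + ε • w.1)) (fun heq => ?_) ?_
  · have hcomb : (v.2⁻¹ - τ⁻¹ * (1 - ε)) • v + (-(τ⁻¹ * ε)) • w = 0 := by
      ext1
      · simp only [Prod.fst_add, Prod.smul_fst, Prod.fst_zero]
        rw [← sub_eq_zero] at heq
        rw [← heq]
        match_scalars <;> ring
      · simp only [Prod.snd_add, Prod.smul_snd, Prod.snd_zero, smul_eq_mul]
        have : τ⁻¹ * τ = 1 := inv_mul_cancel₀ hτ0
        have h2 : v.2⁻¹ * v.2 = 1 := inv_mul_cancel₀ hv0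
        rw [hτ] at this ⊢
        linarith
    refine hne _ _ (Or.inr ?_) hcomb
    simp [hτ0, hε0.ne']
  · rw [segment_eq_image']
    rintro - ⟨t, ⟨ht0, ht1⟩, rfl⟩
    -- homogeneous coordinates of the point at parameter `t`, normalised to total weight one
    obtain ⟨c, hc⟩ : ∃ c, c = (1 - t) * v.2⁻¹ + t * τ⁻¹ := ⟨_, rfl⟩
    have hcv : 0 < c * v.2 := by
      have h2 : v.2⁻¹ * v.2 = 1 := inv_mul_cancel₀ hv0
      have h3 : 0 < τ⁻¹ * v.2 := by
        have : τ⁻¹ * v.2 = τ * v.2 / τ ^ 2 := by field_simp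
        rw [this]; positivity
      have : c * v.2 = (1 - t) + t * (τ⁻¹ * v.2) := by
        rw [hc, add_mul, mul_assoc, h2]; ring
      rw [this]
      rcases ht1.eq_or_lt with rfl | ht1
      · simpa using h3
      · nlinarith [mul_nonneg ht0 h3.le]
    have hc0 : c ≠ 0 := left_ne_zero_of_mul hcv.ne'
    have hpos1 : 0 < v.2⁻¹ / c := by
      have : v.2⁻¹ / c = (c * v.2) / (c * v.2) ^ 2 := by field_simp
      rw [this]; positivity
    have hpos2 : 0 < τ⁻¹ / c := by
      have : τ⁻¹ / c = (τ * v.2) * (c * v.2) / ((τ * c) ^ 2 * v.2 ^ 2) := by field_simp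
      rw [this]; positivity
    obtain ⟨b, hb⟩ : ∃ b, b = t * (τ⁻¹ / c) * ε := ⟨_, rfl⟩
    obtain ⟨a, ha⟩ : ∃ a, a = (1 - t) * (v.2⁻¹ / c) + t * (τ⁻¹ / c) * (1 - ε) := ⟨_, rfl⟩
    have hb0 : 0 ≤ b := by
      rw [hb]; exact mul_nonneg (mul_nonneg ht0 hpos2.le) hε0.le
    have ha0 : 0 ≤ a := by
      rw [ha]
      exact add_nonneg (mul_nonneg (by linarith) hpos1.le)
        (mul_nonneg (mul_nonneg ht0 hpos2.le) (by linarith))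
    have hab : a + b = 1 := by
      have : a + b = c / c := by rw [ha, hb]; nth_rw 4 [hc]; ring
      rw [this, div_self hc0]
    have hca : c * a = (1 - t) * v.2⁻¹ + t * τ⁻¹ * (1 - ε) := by
      rw [ha]; field_simp
    have hcb : c * b = t * τ⁻¹ * ε := by
      rw [hb]; field_simp
    have hsnd : c * (a • v + b • w).2 = 1 := by
      have h2 : v.2⁻¹ * v.2 = 1 := inv_mul_cancel₀ hv0
      have h3 : τ⁻¹ * τ = 1 := inv_mul_cancel₀ hτ0
      simp only [Prod.snd_add, Prod.smul_snd, smul_eq_mul]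
      calc c * (a * v.2 + b * w.2) = (c * a) * v.2 + (c * b) * w.2 := by ring
        _ = (1 - t) * (v.2⁻¹ * v.2) + t * (τ⁻¹ * ((1 - ε) * v.2 + ε * w.2)) := by
          rw [hca, hcb]; ring
        _ = 1 := by rw [← hτ, h2, h3]; ring
    have hinv : (a • v + b • w).2⁻¹ = c := (eq_inv_of_mul_eq_one_left hsnd).symm
    have := hfr a b ha0 hb0 hab (right_ne_zero_of_mul (hsnd.trans_ne one_ne_zero))
    rw [hinv] at this
    convert this using 1
    simp only [Prod.fst_add, Prod.smul_fst, smul_add, smul_smul, hca, hcb]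
    match_scalars <;> ring

theorem IsProperlyConvex.isStrictlyConvexProj_toProj [FiniteDimensional ℝ E] [Nontrivial E]
    (h : IsProperlyConvex Ω) (hq : IsQuasiHomogeneous Ω) (hs : IsStrictlyConvex Ω) :
    IsStrictlyConvexProj (toProj Ω) := by
  have hd := h.toIsConvexDomain
  refine ⟨hd.isConvexProjDomain_toProj, fun v w hlin hsub => ?_⟩
  by_cases hv0 : v.2 = 0
  swap
  · exact hs.not_projImage_segment_subset hlin hv0 hsub
  by_cases hw0 : w.2 = 0
  swap
  · refine hs.not_projImage_segment_subset (LinearIndependent.pair_symm_iff.1 hlin) hw0 ?_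
    rwa [segment_symm]
  obtain ⟨u, hu, hu0⟩ := h.exists_mem_asympCone_ne_zero hq
  have h1 := h.asymptoticDim_eq_one hq hs
  -- With a one-dimensional asymptotic cone, the boundary at infinity is the single point `[u : 0]`,
  -- so `v` and `w` cannot both lie there.
  have key : ∀ p : E × ℝ, p ≠ 0 → p ∈ segment ℝ v w → p.2 = 0 → ∃ c : ℝ, c • (u, (0 : ℝ)) = p := by
    rintro ⟨y, r⟩ hp hps (rfl : r = 0)
    have hmem := frontier_subset_closure (hsub ⟨_, hp, hps, rfl⟩)
    rcases mem_closure_coneOver_of_mk_mem hp hmem with hC | hC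
    · obtain ⟨c, hc⟩ := exists_smul_eq_of_asymptoticDim_eq_one h1 hu
        (hd.mem_asympCone_of_mem_closure_coneOver hC) hu0
      exact ⟨c, by simp [hc]⟩
    · rw [Prod.neg_mk, neg_zero] at hC
      obtain ⟨c, hc⟩ := exists_smul_eq_of_asymptoticDim_eq_one h1 hu
        (hd.mem_asympCone_of_mem_closure_coneOver hC) hu0
      exact ⟨-c, by simp [hc]⟩
  obtain ⟨c, hc⟩ := key v (hlin.ne_zero 0) (left_mem_segment ℝ v w) hv0
  obtain ⟨d, hd'⟩ := key w (hlin.ne_zero 1) (right_mem_segment ℝ v w) hw0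
  rw [LinearIndependent.pair_iff] at hlin
  have h2 := hlin d (-c) (by rw [← hc, ← hd', smul_smul, smul_smul, ← add_smul]; simp [mul_comm])
  have h3 := hlin 1 0 (by
    rw [← hc, neg_eq_zero.1 h2.2]; simp)
  exact one_ne_zero h3.1

end Homogenization

end ConvexDomain

theorem proposition5p5 (n : ℕ) (hn : 0 < n) (Ω : Set (EuclideanSpace ℝ (Fin n)))
    (hconv : ConvexDomain.IsProperlyConvex Ω) (hqh : ConvexDomain.IsQuasiHomogeneous Ω) :
    (ConvexDomain.IsStrictlyConvex Ω ↔ ConvexDomain.asymptoticDim Ω = 1) ∧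
      (ConvexDomain.IsStrictlyConvex Ω →
        ConvexDomain.IsStrictlyConvexProj (ConvexDomain.toProj Ω)) := by
  have : Nonempty (Fin n) := ⟨⟨0, hn⟩⟩
  exact ⟨⟨hconv.asymptoticDim_eq_one hqh, hconv.isStrictlyConvex_of_asymptoticDim hqh⟩,
    hconv.isStrictlyConvexProj_toProj hqh⟩
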